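/- **Definitions.** For integers $n,k>0$ and $m\ge 0$ let $\mathsf{matr}(n,m,k)$ be the set of $n\times m$ matrices with entries in $\{0,\dots,k-1\}$. A *matrix set* is a set of such matrices ($n,m,k$ may vary); a matrix is *empty* if $m=0$. An internal $n$-ary relation on an object $C$ of a category $\mathbb C$ is a jointly monic family $r_1,\dots,r_n\colon R\to C$. For $M\in\mathsf{matr}(n,m,k)$ the category $\mathbb C$ *has $M$-closed relations* if for every such relation, every object $X$ and all morphisms $f_0,\dots,f_{k-1}\colon X\to C$: if for each $j\in\{1,\dots,m\}$ there is $u_j\colon X\to R$ with $r_iu_j=f_{M_{ij}}$ for all $i$, then there is $v\colon X\to R$ with $r_iv=f_0$ for all $i$. For a matrix set $S$, $\mathsf{mclex}\,S$ is the collection of all (locally small) finitely complete categories that have $M$-closed relations for every $M\in S$. A matrix $M$ is *trivial* if every category in $\mathsf{mclex}\{M\}$ is a preorder (any two parallel morphisms are equal). A relation $R\subseteq X^{n'}$ on a set $X$ is *$M$-sharp* if for every $n'\times m$ matrix $M'$ each of whose rows is a row of $M$, and all functions $f_1,\dots,f_{n'}\colon\{0,\dots,k-1\}\to X$: if $(f_i(M'_{ij}))_{i}\in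 R$ for every $j\in\{1,\dots,m\}$, then $(f_i(0))_i\in R$. For $N\in\mathsf{matr}(n,m,k)$, let $\mathsf{col}(N)\subseteq\{0,\dots,k-1\}^n$ be the set of columns of $N$, and let $\mathsf{col}^S(N)$ be the least (that is, the intersection of all) $n$-ary relation(s) on $\{0,\dots,k-1\}$ that contain $\mathsf{col}(N)$ and are $M$-sharp for all $M\in S$. Let $[0]_n$ be the column of $n$ zeros. **Statement.** Let $S$ and $U$ be matrix sets. 1. If $[0]_n\in\mathsf{col}^S(N)$ for every $n>0$ and every $N\in U$ with $n$ rows, then $\mathsf{mclex}\,S\subseteq\mathsf{mclex}\,U$. 2. Conversely, if no matrix in $S$ is trivial and $\mathsf{mclex}\,S\subseteq\mathsf{mclex}\,U$, then $[0]_n\in\mathsf{col}^S(N)$ for every $n>0$ and every $N\in U$ with $n$ rows. 3. If $S$ is finite and $N$ is any matrix, then $\mathsf{col}^S(N)$ is computed as follows: start with $R=\mathsf{col}(N)$ and keep adding to $R\subseteq\{0,\dots,k-1\}^n$ all columns $(f_i(0))_i$ for which there are $M\in S$, say $M\in\mathsf{matr}(n'',m'',k'')$, an $n\times m''$ matrix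 $M'$ whose rows are rows of $M$, and functions $f_1,\dots,f_n\colon\{0,\dots,k''-1\}\to\{0,\dots,k-1\}$ with $(f_i(M'_{ij}))_i\in R$ for all $j$, until $R$ no longer grows (which happens after finitely many rounds); the final $R$ is $\mathsf{col}^S(N)$. 4. If $S$ and $U$ are finite, the following algorithm decides whether $\mathsf{mclex}\,S\subseteq\mathsf{mclex}\,U$. * Step 0. If $S$ contains an empty matrix, answer yes; otherwise, if $U$ contains an empty matrix, answer no. * Step 1. If some matrix in $S$ has a row without $0$, answer yes. Otherwise, if some $M\in S$ has two distinct rows such that the first $0$ in the one is not linked to any $0$ in the other, answer yes. (Two positions in two rows are *linked* if they are joined by a path that moves between the two positions of one column and between equal entries of one of the two rows.) * Step 2. For each $N\in U$ compute $\mathsf{col}^S(N)$ as in 3; if for some $N\in U$, with $n$ rows, $[0]_n\notin\mathsf{col}^S(N)$, answer no. * Step 3. Otherwise answer yes. -/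

import Mathlib

open CategoryTheory CategoryTheory.Limits

universe u

namespace LexMatrix

/-- An element of the disjoint union, over `n > 0`, `m ≥ 0`, `k > 0`, of the sets of all `n × m`
matrices with entries in `{0, …, k - 1}`. -/
structure Matr where
  n : ℕ
  m : ℕ
  k : ℕ
  [n_ne : NeZero n]
  [k_ne : NeZero k]
  entry : Fin n → Fin m → Fin k

attribute [instance] Matr.n_ne Matr.k_ne

/-! ### Matrix properties of categories -/

/-- An internal `n`-ary relation on the object `C`: a jointly monic family of `n` morphisms
`r i : R ⟶ C`. -/
def IsInternalRelation {𝒞 : Type*} [Category 𝒞] {n : ℕ} {R C : 𝒞} (r : Fin n → (R ⟶ C)) : Prop :=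
  ∀ ⦃X : 𝒞⦄ (x y : X ⟶ R), (∀ i, x ≫ r i = y ≫ r i) → x = y

/-- The family `r` is `M`-closed over `X`: it is compatible with every (non-row-wise)
interpretation `f` of `M` of type `Hom(X, C)`. The right column of the interpretation is
constantly `f 0`. -/
def IsClosedOver {𝒞 : Type*} [Category 𝒞] (M : Matr) {R C : 𝒞} (r : Fin M.n → (R ⟶ C))
    (X : 𝒞) : Prop :=
  ∀ f : Fin M.k → (X ⟶ C),
    (∀ j : Fin M.m, ∃ w : X ⟶ R, ∀ i, w ≫ r i = f (M.entry i j)) →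
      ∃ v : X ⟶ R, ∀ i, v ≫ r i = f 0

/-- The category `𝒞` has `M`-closed relations. -/
def HasClosedRelations (M : Matr) (𝒞 : Type*) [Category 𝒞] : Prop :=
  ∀ ⦃R C : 𝒞⦄ (r : Fin M.n → (R ⟶ C)), IsInternalRelation r → ∀ X : 𝒞, IsClosedOver M r X

/-- The collection of all left exact (i.e. finitely complete) categories having `M`-closed
relations for all `M` in `S`. -/
def mclex (S : Set Matr) : Set Cat.{u, u + 1} :=
  {𝒞 | HasFiniteLimits 𝒞 ∧ ∀ M ∈ S, HasClosedRelations M 𝒞}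

/-- A matrix is trivial if every left exact category with `M`-closed relations is a preorder. -/
def IsTrivial (M : Matr) : Prop :=
  ∀ 𝒞 ∈ mclex.{u} {M}, Quiver.IsThin 𝒞

/-! ### Ordinary relations: strict closedness, sharpness, and the relation `col^S(N)` -/

/-- The `n`-ary relation `R` on the set `X` is strictly `A`-closed: it is compatible with every
row-wise interpretation of `A` of type `(X, …, X)`. -/
def IsStrictlyClosed {X : Type*} {n m k : ℕ} [NeZero k] (A : Fin n → Fin m → Fin k)
    (R : Set (Fin n → X)) : Prop :=
  ∀ f : Fin n → Fin k → X,
    (∀ j : Fin m, (fun i => f i (A i j)) ∈ R) → (fun i => f i 0) ∈ R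

/-- The `n`-ary relation `R` is `M`-sharp: it is strictly closed under every `n`-row matrix each
of whose rows is a row of `M`. -/
def IsSharp {X : Type*} {n : ℕ} (M : Matr) (R : Set (Fin n → X)) : Prop :=
  ∀ σ : Fin n → Fin M.n, IsStrictlyClosed (fun i => M.entry (σ i)) R

/-- The set of columns of `N`, as an `N.n`-ary relation on `{0, …, N.k - 1}`. -/
def col (N : Matr) : Set (Fin N.n → Fin N.k) :=
  Set.range fun (j : Fin N.m) (i : Fin N.n) => N.entry i j

/-- `col^S(N)`: the intersection of all relations on `{0, …, N.k - 1}` that contain `col N` and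
are `M`-sharp for all `M` in `S`. -/
def colS (S : Set Matr) (N : Matr) : Set (Fin N.n → Fin N.k) :=
  ⋂₀ {R | col N ⊆ R ∧ ∀ M ∈ S, IsSharp M R}

/-- The column with `N.n` rows all of whose entries are `0`. -/
def zeroCol (N : Matr) : Fin N.n → Fin N.k := fun _ => 0

/-! ### The algorithm, for finite matrix sets given as lists -/

/-- One round of expansion: add to `R` the right columns of all row-wise interpretations (of type
`({0, …, k - 1}, …, {0, …, k - 1})`) of the `n`-row matrices whose rows are rows of a common matrix
`M` in `S`, such that all left columns of the interpretation belong to `R`. -/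
def expandStep (S : List Matr) {n k : ℕ} (R : Finset (Fin n → Fin k)) :
    Finset (Fin n → Fin k) :=
  R ∪ Finset.univ.filter fun c =>
    ∃ M ∈ S, ∃ σ : Fin n → Fin M.n, ∃ f : Fin n → Fin M.k → Fin k,
      (∀ j : Fin M.m, (fun i => f i (M.entry (σ i) j)) ∈ R) ∧ c = fun i => f i 0

theorem subset_expandStep (S : List Matr) {n k : ℕ} (R : Finset (Fin n → Fin k)) :
    R ⊆ expandStep S R :=
  Finset.subset_union_left

/-- Keep expanding `R` until it is impossible to expand it further. -/
def expand (S : List Matr) {n k : ℕ} (R : Finset (Fin n → Fin k)) : Finset (Fin n → Fin k) :=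
  if expandStep S R = R then R else expand S (expandStep S R)
termination_by Rᶜ.card
decreasing_by
  rename_i h
  exact Finset.card_lt_card
    (Finset.compl_ssubset_compl.2 ((subset_expandStep S R).ssubset_of_ne (Ne.symm h)))

/-- The finite set of columns of `N`. -/
def colFinset (N : Matr) : Finset (Fin N.n → Fin N.k) :=
  Finset.univ.image fun (j : Fin N.m) (i : Fin N.n) => N.entry i j

/-- The columns that can be reached from column `j` by a linkage in rows `a` and `b`, i.e. by a path
that moves between the two positions of one column, and between positions of one of the two rows
that hold equal entries. As there are `M.m` columns, `M.m` rounds of search suffice. -/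
def linkageClass (M : Matr) (a b : Fin M.n) (j : Fin M.m) : Finset (Fin M.m) :=
  (fun A : Finset (Fin M.m) => Finset.univ.filter fun q =>
    ∃ p ∈ A, M.entry a p = M.entry a q ∨ M.entry b p = M.entry b q)^[M.m] {j}

/-- The position of the first `0` in row `a`, if there is one. -/
def firstZero (M : Matr) (a : Fin M.n) : Option (Fin M.m) :=
  (List.finRange M.m).find? fun j => decide (M.entry a j = 0)

/-- The test for triviality of a non-empty matrix: some row has no `0`, or for some pair of distinct
rows no `0` of the second row is linked to the chosen `0` of the first. -/
def trivialTest (M : Matr) : Bool :=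
  decide (∃ a : Fin M.n, ∀ j : Fin M.m, M.entry a j ≠ 0) ||
    decide (∃ a b : Fin M.n, a ≠ b ∧
      ∃ j : Fin M.m, firstZero M a = some j ∧ ∀ q ∈ linkageClass M a b j, M.entry b q ≠ 0)

/-- The algorithm deciding whether `mclex S ⊆ mclex U`. -/
def decideInclusion (S U : List Matr) : Bool :=
  if ∃ M ∈ S, M.m = 0 then true
  else if ∃ N ∈ U, N.m = 0 then false
  else if ∃ M ∈ S, trivialTest M = true then true
  else decide (∀ N ∈ U, zeroCol N ∈ expand S (colFinset N))

end LexMatrix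

/-! Sufficiency: fix a relation `r` on `C` and morphisms `f t : X ⟶ C`. The index tuples `c` for
which `(f (c i))_i` factors through `r` form an ordinary relation, and `M`-closedness of the
category makes it `M`-sharp (`HasClosedRelations.isSharp`). If it contains `col N`, it contains
`colS S N`, hence the zero column.

Necessity: sets with an `n`-ary relation sharp for all of `S` form a cocomplete category `SharpRel`.
Its opposite has `M`-closed relations for every `M ∈ S` that fails `trivialTest`
(`hasClosedRelations_op`). Applying `N`-closedness there to a generic tuple mapped into `colS S N`
gives the zero column (`zeroCol_mem_colS`).

The test enters twice: passing it forces preorders (`isThin_of_trivialTest`), failing it gives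
exactly the well-definedness needed in `SharpRel` (`eq_at_zero_of_trivialTest_eq_false`). Preorders
satisfy every non-empty matrix condition; empty matrices are settled separately by the two-element
chain. -/

namespace LexMatrix

/-! ### Closure under sharpness -/

/-- The least relation that contains `R` and is `M`-sharp for all `M` in `S`. -/
def sharpClosure (S : Set Matr) {X : Type*} {n : ℕ} (R : Set (Fin n → X)) : Set (Fin n → X) :=
  ⋂₀ {R' | R ⊆ R' ∧ ∀ M ∈ S, IsSharp M R'}

theorem subset_sharpClosure (S : Set Matr) {X : Type*} {n : ℕ} (R : Set (Fin n → X)) :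
    R ⊆ sharpClosure S R :=
  Set.subset_sInter fun _ h => h.1

theorem sharpClosure_subset {S : Set Matr} {X : Type*} {n : ℕ} {R R' : Set (Fin n → X)}
    (h : R ⊆ R') (h' : ∀ M ∈ S, IsSharp M R') : sharpClosure S R ⊆ R' :=
  Set.sInter_subset_of_mem ⟨h, h'⟩

theorem isSharp_sharpClosure {S : Set Matr} {M : Matr} (hM : M ∈ S) {X : Type*} {n : ℕ}
    (R : Set (Fin n → X)) : IsSharp M (sharpClosure S R) := fun σ f hf R' hR' =>
  hR'.2 M hM σ f fun j => hf j R' hR'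

/-- An interpretation can be composed with `g`. This gives generated sharp relations their universal
property. -/
theorem IsSharp.preimage {M : Matr} {X Y : Type*} {n : ℕ} {R : Set (Fin n → Y)}
    (hR : IsSharp M R) (g : X → Y) : IsSharp M {x : Fin n → X | g ∘ x ∈ R} :=
  fun σ f hf => hR σ (fun i t => g (f i t)) hf

theorem isSharp_univ (M : Matr) {X : Type*} {n : ℕ} : IsSharp M (Set.univ : Set (Fin n → X)) :=
  fun _ _ _ => trivial

/-! ### Sufficiency of the condition on columns -/

theorem exists_power {𝒞 : Type*} [Category 𝒞] [HasFiniteLimits 𝒞] (C : 𝒞) (n : ℕ) :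
    ∃ (P : 𝒞) (π : Fin n → (P ⟶ C)), IsInternalRelation π ∧
      ∀ {X : 𝒞} (f : Fin n → (X ⟶ C)), ∃ z : X ⟶ P, ∀ i, z ≫ π i = f i :=
  ⟨∏ᶜ fun _ => C, Pi.π fun _ => C, fun _ _ _ h => Pi.hom_ext _ _ h,
    fun f => ⟨Pi.lift f, fun i => by simp⟩⟩

/-- In a left exact category having `M`-closed relations, the trace of a
relation on finitely many morphisms is `M`-sharp. -/
theorem HasClosedRelations.isSharp {𝒞 : Type*} [Category 𝒞] [HasFiniteLimits 𝒞] {M : Matr}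
    (hM : HasClosedRelations M 𝒞) {n : ℕ} {R C X : 𝒞} {r : Fin n → (R ⟶ C)}
    (hr : IsInternalRelation r) {ι : Type*} (f : ι → (X ⟶ C)) :
    IsSharp M {c : Fin n → ι | ∃ w : X ⟶ R, ∀ i, w ≫ r i = f (c i)} := by
  intro σ g hg
  obtain ⟨P, π, hπ, hπ'⟩ := exists_power C n
  obtain ⟨Q, ρ, hρ, hρ'⟩ := exists_power P M.n
  -- The pullback of `a` and `b` is the `M.n`-ary relation on `P = C^n` of those tuples `(x_l)` for
  -- which the `i`-th coordinates of `x_(σ i)` together form an element of `R`. This turns the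
  -- row-wise condition into ordinary `M`-closedness.
  obtain ⟨a, ha⟩ := hπ' r
  obtain ⟨b, hb⟩ := hπ' fun i => ρ (σ i) ≫ π i
  have hs : IsInternalRelation fun l => pullback.snd a b ≫ ρ l := by
    intro Y x y hxy
    have h2 : x ≫ pullback.snd a b = y ≫ pullback.snd a b :=
      hρ _ _ fun l => by simpa using hxy l
    refine pullback.hom_ext (hr _ _ fun i => ?_) h2
    simp only [← ha, Category.assoc, pullback.condition_assoc]
    rw [reassoc_of% h2]
  have hlift : ∀ t : Fin M.k, ∃ z : X ⟶ P, ∀ i, z ≫ π i = f (g i t) := fun t => hπ' _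
  choose z hz using hlift
  obtain ⟨v, hv⟩ := hM _ hs X z fun j => by
    obtain ⟨w, hw⟩ := hg j
    obtain ⟨y, hy⟩ := hρ' fun l => z (M.entry l j)
    refine ⟨pullback.lift w y (hπ _ _ fun i => ?_), fun l => ?_⟩
    · simp only [Category.assoc, ha, hb, hw, reassoc_of% hy, hz]
    · rw [pullback.lift_snd_assoc, hy]
  refine ⟨v ≫ pullback.fst a b, fun i => ?_⟩
  rw [← ha, Category.assoc, pullback.condition_assoc, hb, ← hz, ← hv (σ i)]
  simp only [Category.assoc]

theorem mclex_subset_of_zeroCol_mem {S U : Set Matr} (h : ∀ N ∈ U, zeroCol N ∈ colS S N) :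
    mclex.{u} S ⊆ mclex.{u} U := by
  rintro 𝒞 ⟨hlim, hS⟩
  refine ⟨hlim, fun N hN R C r hr X f hf => ?_⟩
  refine h N hN {c | ∃ w : X ⟶ R, ∀ i, w ≫ r i = f (c i)} ⟨?_, fun M hM => ?_⟩
  · rintro _ ⟨j, rfl⟩
    exact hf j
  · exact (hS M hM).isSharp hr f

/-! ### Computing the closure -/

theorem subset_expand (S : List Matr) {n k : ℕ} (R : Finset (Fin n → Fin k)) :
    R ⊆ expand S R := by
  induction R using expand.induct S with
  | case1 R h => rw [expand, if_pos h]
  | case2 R h ih =>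
    rw [expand, if_neg h]
    exact (subset_expandStep S R).trans ih

theorem expandStep_expand (S : List Matr) {n k : ℕ} (R : Finset (Fin n → Fin k)) :
    expandStep S (expand S R) = expand S R := by
  induction R using expand.induct S with
  | case1 R h => rw [expand, if_pos h, h]
  | case2 R h ih => rwa [expand, if_neg h]

theorem expandStep_subset {S : List Matr} {n k : ℕ} {R : Finset (Fin n → Fin k)}
    {R' : Set (Fin n → Fin k)} (h : (R : Set (Fin n → Fin k)) ⊆ R')
    (h' : ∀ M ∈ S, IsSharp M R') : (expandStep S R : Set (Fin n → Fin k)) ⊆ R' := by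
  intro c hc
  rcases Finset.mem_union.1 hc with hc | hc
  · exact h hc
  · obtain ⟨M, hM, σ, f, hf, rfl⟩ := (Finset.mem_filter.1 hc).2
    exact h' M hM σ f fun j => h (hf j)

theorem expand_subset {S : List Matr} {n k : ℕ} {R : Finset (Fin n → Fin k)}
    {R' : Set (Fin n → Fin k)} (h : (R : Set (Fin n → Fin k)) ⊆ R')
    (h' : ∀ M ∈ S, IsSharp M R') : (expand S R : Set (Fin n → Fin k)) ⊆ R' := by
  induction R using expand.induct S with
  | case1 R hR => rwa [expand, if_pos hR]
  | case2 R hR ih =>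
    rw [expand, if_neg hR]
    exact ih (expandStep_subset h h')

theorem isSharp_expand {S : List Matr} {M : Matr} (hM : M ∈ S) {n k : ℕ}
    (R : Finset (Fin n → Fin k)) : IsSharp M (expand S R : Set (Fin n → Fin k)) := by
  intro σ f hf
  rw [← expandStep_expand]
  exact Finset.mem_union_right _
    (Finset.mem_filter.2 ⟨Finset.mem_univ _, M, hM, σ, f, hf, rfl⟩)

theorem coe_colFinset (N : Matr) : (colFinset N : Set (Fin N.n → Fin N.k)) = col N := by
  simp [colFinset, col]

/-- A stable set is sharp, and no round leaves a sharp relation containing the start. -/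
theorem coe_expand_colFinset (S : List Matr) (N : Matr) :
    (expand S (colFinset N) : Set (Fin N.n → Fin N.k)) = colS {M | M ∈ S} N := by
  refine Set.Subset.antisymm ?_ ?_
  · exact expand_subset ((coe_colFinset N).trans_subset (subset_sharpClosure _ _))
      fun M hM => isSharp_sharpClosure (S := {M | M ∈ S}) hM _
  · exact sharpClosure_subset
      ((coe_colFinset N).symm.trans_subset (Finset.coe_subset.2 (subset_expand S _)))
      fun M hM => isSharp_expand hM _

/-! ### Linkage and triviality -/

/-- One round of the search for the columns linked to those in `A`. -/
def linkageStep (M : Matr) (a b : Fin M.n) (A : Finset (Fin M.m)) : Finset (Fin M.m) :=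
  Finset.univ.filter fun q => ∃ p ∈ A, M.entry a p = M.entry a q ∨ M.entry b p = M.entry b q

theorem subset_linkageStep (M : Matr) (a b : Fin M.n) (A : Finset (Fin M.m)) :
    A ⊆ linkageStep M a b A := fun q hq =>
  Finset.mem_filter.2 ⟨Finset.mem_univ _, q, hq, Or.inl rfl⟩

/-- Each round before stabilisation adds an element, so after `card α` rounds the set is either
stable or everything. -/
theorem iterate_card_isFixedPt_of_subset {α : Type*} [Fintype α]
    {F : Finset α → Finset α} (hF : ∀ A, A ⊆ F A) (A : Finset α) :
    F (F^[Fintype.card α] A) = F^[Fintype.card α] A := by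
  have key : ∀ t, F (F^[t] A) = F^[t] A ∨ t ≤ (F^[t] A).card := by
    intro t
    induction t with
    | zero => exact Or.inr (Nat.zero_le _)
    | succ t ih =>
      rw [Function.iterate_succ_apply']
      by_cases h : F (F^[t] A) = F^[t] A
      · exact Or.inl (by rw [h, h])
      · have h1 := ih.resolve_left h
        have h2 := Finset.card_lt_card ((hF (F^[t] A)).ssubset_of_ne (Ne.symm h))
        exact Or.inr (by omega)
  rcases key (Fintype.card α) with h | h
  · exact h
  · have h1 : F^[Fintype.card α] A = Finset.univ :=
      Finset.card_eq_iff_eq_univ _ |>.1 (le_antisymm (Finset.card_le_univ _) h)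
    rw [h1]
    exact Finset.univ_subset_iff.1 (hF _)

theorem linkageStep_linkageClass (M : Matr) (a b : Fin M.n) (j : Fin M.m) :
    linkageStep M a b (linkageClass M a b j) = linkageClass M a b j := by
  have := iterate_card_isFixedPt_of_subset (subset_linkageStep M a b) {j}
  rwa [Fintype.card_fin] at this

theorem self_mem_linkageClass (M : Matr) (a b : Fin M.n) (j : Fin M.m) :
    j ∈ linkageClass M a b j := by
  have : ∀ t, j ∈ (linkageStep M a b)^[t] {j} := by
    intro t
    induction t with
    | zero => exact Finset.mem_singleton_self j
    | succ t ih =>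
      rw [Function.iterate_succ_apply']
      exact subset_linkageStep _ _ _ _ ih
  exact this M.m

theorem linkageClass_induction {M : Matr} {a b : Fin M.n} {j : Fin M.m} {P : Fin M.m → Prop}
    (base : P j) (left : ∀ p q, P p → M.entry a p = M.entry a q → P q)
    (right : ∀ p q, P p → M.entry b p = M.entry b q → P q) :
    ∀ q ∈ linkageClass M a b j, P q := by
  have : ∀ t, ∀ q ∈ (linkageStep M a b)^[t] {j}, P q := by
    intro t
    induction t with
    | zero =>
      intro q hq
      rwa [Finset.mem_singleton.1 hq]
    | succ t ih =>
      intro q hq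
      rw [Function.iterate_succ_apply'] at hq
      obtain ⟨p, hp, h | h⟩ := (Finset.mem_filter.1 hq).2
      · exact left p q (ih p hp) h
      · exact right p q (ih p hp) h
  exact this M.m

theorem mem_linkageClass_of_eq_left {M : Matr} {a b : Fin M.n} {j p q : Fin M.m}
    (hp : p ∈ linkageClass M a b j) (h : M.entry a p = M.entry a q) :
    q ∈ linkageClass M a b j := by
  rw [← linkageStep_linkageClass]
  exact Finset.mem_filter.2 ⟨Finset.mem_univ _, p, hp, Or.inl h⟩

theorem mem_linkageClass_of_eq_right {M : Matr} {a b : Fin M.n} {j p q : Fin M.m}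
    (hp : p ∈ linkageClass M a b j) (h : M.entry b p = M.entry b q) :
    q ∈ linkageClass M a b j := by
  rw [← linkageStep_linkageClass]
  exact Finset.mem_filter.2 ⟨Finset.mem_univ _, p, hp, Or.inr h⟩

theorem entry_eq_zero_of_firstZero {M : Matr} {a : Fin M.n} {j : Fin M.m}
    (h : firstZero M a = some j) : M.entry a j = 0 := by
  simpa using List.find?_some h

theorem exists_firstZero {M : Matr} {a : Fin M.n} {j : Fin M.m} (h : M.entry a j = 0) :
    ∃ p, firstZero M a = some p := by
  rw [← Option.isSome_iff_exists, firstZero, List.find?_isSome]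
  exact ⟨j, List.mem_finRange j, by simpa using h⟩

/-- If the entries of two rows of `M` can be separated from `0` compatibly with the columns of `M`,
then a left exact category with `M`-closed relations is a preorder. -/
theorem HasClosedRelations.isThin_of_separation {𝒞 : Type*} [Category 𝒞] [HasFiniteLimits 𝒞]
    {M : Matr} (hM : HasClosedRelations M 𝒞) {a b : Fin M.n} {α β : Fin M.k → Bool}
    (h : ∀ j, α (M.entry a j) = β (M.entry b j)) (h0 : α 0 ≠ β 0) : Quiver.IsThin 𝒞 := by
  intro X Y
  refine ⟨fun p q => ?_⟩
  obtain ⟨Q, ρ, hρ, hρ'⟩ := exists_power (Y ⨯ Y) M.n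
  let c : Bool → (X ⟶ Y) := fun x => bif x then p else q
  -- The relation on `Y ⨯ Y` demands that the first coordinate of entry `a` equal the second
  -- coordinate of entry `b`. Interpreting `e` as `(c (α e), c (β e))` satisfies it at every column
  -- of `M`; at `0` it says `p = q`.
  have hr : IsInternalRelation fun i => equalizer.ι (ρ a ≫ prod.fst) (ρ b ≫ prod.snd) ≫ ρ i := by
    intro Z x y hxy
    refine equalizer.hom_ext (hρ _ _ fun i => ?_)
    simpa using hxy i
  obtain ⟨v, hv⟩ := hM _ hr X (fun e => prod.lift (c (α e)) (c (β e))) fun j => by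
    obtain ⟨y, hy⟩ := hρ' fun i => prod.lift (c (α (M.entry i j))) (c (β (M.entry i j)))
    refine ⟨equalizer.lift y ?_, fun i => ?_⟩
    · rw [reassoc_of% hy, reassoc_of% hy, prod.lift_fst, prod.lift_snd, h]
    · rw [equalizer.lift_ι_assoc, hy]
  have hc : c (α 0) = c (β 0) := by
    rw [← prod.lift_fst (c (α 0)) (c (β 0)), ← hv a, Category.assoc, Category.assoc,
      equalizer.condition, ← Category.assoc, ← Category.assoc, Category.assoc v, hv b,
      prod.lift_snd]
  revert hc h0
  cases α 0 <;> cases β 0 <;> simp [c, eq_comm]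

theorem HasClosedRelations.isThin_of_trivialTest {𝒞 : Type*} [Category 𝒞] [HasFiniteLimits 𝒞]
    {M : Matr} (hM : HasClosedRelations M 𝒞) (h : trivialTest M = true) : Quiver.IsThin 𝒞 := by
  classical
  rw [trivialTest, Bool.or_eq_true, decide_eq_true_iff, decide_eq_true_iff] at h
  rcases h with ⟨a, ha⟩ | ⟨a, b, -, j, hj, hb⟩
  · refine hM.isThin_of_separation (a := a) (b := a) (α := fun _ => true)
      (β := fun e => decide (e ≠ 0)) (fun j => ?_) ?_
    · simp [ha j]
    · simp
  -- Each row is coloured by which of its entries occur in the linkage class; closure of the class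
  -- under equal entries makes the colours agree columnwise.
  · refine hM.isThin_of_separation (a := a) (b := b)
      (α := fun e => decide (∃ p ∈ linkageClass M a b j, M.entry a p = e))
      (β := fun e => decide (∃ p ∈ linkageClass M a b j, M.entry b p = e)) (fun q => ?_) ?_
    · rw [decide_eq_decide]
      constructor
      · rintro ⟨p, hp, hpq⟩
        exact ⟨q, mem_linkageClass_of_eq_left hp hpq, rfl⟩
      · rintro ⟨p, hp, hpq⟩
        exact ⟨q, mem_linkageClass_of_eq_right hp hpq, rfl⟩
    · have h1 : ∃ p ∈ linkageClass M a b j, M.entry a p = 0 :=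
        ⟨j, self_mem_linkageClass M a b j, entry_eq_zero_of_firstZero hj⟩
      have h2 : ¬ ∃ p ∈ linkageClass M a b j, M.entry b p = 0 := by
        rintro ⟨p, hp, hp0⟩
        exact hb p hp hp0
      simp only [h1, h2, decide_true, decide_false]
      decide

theorem isTrivial_of_trivialTest {M : Matr} (h : trivialTest M = true) : IsTrivial.{u} M := by
  rintro 𝒞 ⟨hlim, hM⟩
  exact (hM M rfl).isThin_of_trivialTest h

theorem trivialTest_of_isEmpty {M : Matr} (h : M.m = 0) : trivialTest M = true := by
  rw [trivialTest, Bool.or_eq_true, decide_eq_true_iff]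
  exact Or.inl ⟨0, fun j => absurd j.2 (by omega)⟩

/-- If `M` fails the triviality test, then equality of the values of two maps at all the
columns of two rows of `M` forces equality of their values at `0`. -/
theorem eq_at_zero_of_trivialTest_eq_false {M : Matr} (hM : trivialTest M = false) {Y : Type*}
    {g g' : Fin M.k → Y} {a b : Fin M.n} (h : ∀ j, g (M.entry a j) = g' (M.entry b j)) :
    g 0 = g' 0 := by
  rw [trivialTest, Bool.or_eq_false_iff, decide_eq_false_iff_not, decide_eq_false_iff_not] at hM
  push Not at hM
  obtain ⟨j, hj⟩ := hM.1 a
  rcases eq_or_ne a b with rfl | hab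
  · have := h j
    rwa [hj] at this
  obtain ⟨p, hp⟩ := exists_firstZero hj
  obtain ⟨q, hq, hq0⟩ := hM.2 a b hab p hp
  -- The value of `g` on row `a` is constant along a linkage: a move in row `b` is transferred
  -- through `h` to `g'` and back.
  have key : g (M.entry a p) = g (M.entry a q) := by
    refine linkageClass_induction (P := fun q => g (M.entry a p) = g (M.entry a q)) rfl
      (fun s t hs hst => by rw [hs, hst]) (fun s t hs hst => by rw [hs, h, h, hst]) q hq
  rw [← entry_eq_zero_of_firstZero hp, key, h, hq0, entry_eq_zero_of_firstZero hp]

/-! ### Sets equipped with a sharp relation -/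

/-- A set equipped with an `n`-ary relation that is `M`-sharp for all `M` in `S`. -/
structure SharpRel (S : Set Matr) (n : ℕ) : Type (u + 1) where
  carrier : Type u
  rel : Set (Fin n → carrier)
  isSharp : ∀ M ∈ S, IsSharp M rel

namespace SharpRel

variable {S : Set Matr} {n : ℕ}

/-- A map preserving the relation. -/
@[ext]
structure Hom (A B : SharpRel.{u} S n) : Type u where
  toFun : A.carrier → B.carrier
  map_rel : ∀ x ∈ A.rel, toFun ∘ x ∈ B.rel

instance : Category (SharpRel.{u} S n) where
  Hom := Hom
  id _ := ⟨id, fun _ h => h⟩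
  comp f g := ⟨g.toFun ∘ f.toFun, fun x h => g.map_rel _ (f.map_rel x h)⟩

@[ext]
theorem hom_ext {A B : SharpRel.{u} S n} {f g : A ⟶ B} (h : ∀ x, f.toFun x = g.toFun x) : f = g :=
  Hom.ext (funext h)

@[simp]
theorem comp_toFun {A B C : SharpRel.{u} S n} (f : A ⟶ B) (g : B ⟶ C) (x : A.carrier) :
    (f ≫ g).toFun x = g.toFun (f.toFun x) :=
  rfl

/-- The underlying set of a set equipped with a sharp relation. -/
def forget : SharpRel.{u} S n ⥤ Type u where
  obj A := A.carrier
  map f := TypeCat.ofHom f.toFun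

/-- The sharp relation generated by a relation on a set. -/
def free (S : Set Matr) {X : Type u} (R : Set (Fin n → X)) : SharpRel.{u} S n :=
  ⟨X, sharpClosure S R, fun _ hM => isSharp_sharpClosure hM R⟩

/-- The map on a generated sharp relation induced by a map preserving the generators. -/
def free.desc {X : Type u} {R : Set (Fin n → X)} {B : SharpRel.{u} S n}
    (f : X → B.carrier) (hf : ∀ x ∈ R, f ∘ x ∈ B.rel) : free S R ⟶ B :=
  ⟨f, fun _ hx => sharpClosure_subset (R' := {x | f ∘ x ∈ B.rel}) hf
    (fun M hM => (B.isSharp M hM).preimage f) hx⟩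

/-- The set `X` equipped with the relation that always holds. -/
def indiscrete (S : Set Matr) (n : ℕ) (X : Type u) : SharpRel.{u} S n :=
  ⟨X, Set.univ, fun M _ => isSharp_univ M⟩

/-- Any map into an indiscrete object is a morphism. -/
def toIndiscrete (A : SharpRel.{u} S n) {X : Type u} (f : A.carrier → X) :
    A ⟶ indiscrete S n X :=
  ⟨f, fun _ _ => trivial⟩

section Colimits

variable {J : Type u} [SmallCategory J] (F : J ⥤ SharpRel.{u} S n)

/-- The colimit of a diagram of sharp relations: the colimit of the underlying sets, equipped with
the sharp relation generated by the images of the given ones. -/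
noncomputable def colimitCocone : Cocone F where
  pt := free S (X := colimit (F ⋙ forget))
    {x | ∃ j, ∃ y ∈ (F.obj j).rel, x = fun i => colimit.ι (F ⋙ forget) j (y i)}
  ι :=
    { app := fun j => ⟨fun y => colimit.ι (F ⋙ forget) j y,
        fun y hy => subset_sharpClosure _ _ ⟨j, y, hy, rfl⟩⟩
      naturality := fun j j' f => by
        ext x
        exact ConcreteCategory.congr_hom (colimit.w (F ⋙ forget) f) x }

/-- The cocone `colimitCocone F` is a colimit. -/
noncomputable def isColimitColimitCocone : IsColimit (colimitCocone F) where
  desc s := free.desc (fun x => colimit.desc (F ⋙ forget) (forget.mapCocone s) x) (by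
    rintro _ ⟨j, y, hy, rfl⟩
    have : ((fun x => colimit.desc (F ⋙ forget) (forget.mapCocone s) x) ∘
        fun i => colimit.ι (F ⋙ forget) j (y i)) = (s.ι.app j).toFun ∘ y := by
      ext i
      exact ConcreteCategory.congr_hom (colimit.ι_desc (forget.mapCocone s) j) (y i)
    have h := (s.ι.app j).map_rel y hy
    rw [← this] at h
    exact h)
  fac s j := by
    ext x
    exact ConcreteCategory.congr_hom (colimit.ι_desc (forget.mapCocone s) j) x
  uniq s m hm := by
    have : forget.map m = colimit.desc (F ⋙ forget) (forget.mapCocone s) := by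
      refine colimit.hom_ext fun j => ?_
      rw [colimit.ι_desc]
      exact congrArg forget.map (hm j)
    ext x
    exact ConcreteCategory.congr_hom this x

end Colimits

/-- Needed for the finite limits of the opposite category. -/
instance : HasColimits (SharpRel.{u} S n) :=
  ⟨fun _ _ => ⟨fun F => ⟨⟨⟨colimitCocone F, isColimitColimitCocone F⟩⟩⟩⟩⟩

/-- A jointly epic family of morphisms is jointly surjective. -/
theorem exists_eq_of_isInternalRelation {m : ℕ} {R C : (SharpRel.{u} S n)ᵒᵖ} {r : Fin m → (R ⟶ C)}
    (hr : IsInternalRelation r) (x : R.unop.carrier) :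
    ∃ i, ∃ c : C.unop.carrier, (r i).unop.toFun c = x := by
  classical
  -- The indicator of the joint image and the constant `True` agree on that image, so joint epicness
  -- identifies them.
  let f : R.unop ⟶ indiscrete S n (ULift.{u} Prop) := toIndiscrete _ fun x =>
    ⟨∃ i, ∃ c : C.unop.carrier, (r i).unop.toFun c = x⟩
  let g : R.unop ⟶ indiscrete S n (ULift.{u} Prop) := toIndiscrete _ fun _ => ⟨True⟩
  have h : f.op = g.op := hr _ _ fun i => Quiver.Hom.unop_inj (by
    ext c
    have : (∃ i', ∃ c' : C.unop.carrier, (r i').unop.toFun c' = (r i).unop.toFun c) = True :=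
      eq_true ⟨i, c, rfl⟩
    exact congrArg ULift.up this)
  have h1 : f.toFun x = g.toFun x := by rw [Quiver.Hom.op_inj h]
  exact of_eq_true (congrArg ULift.down h1)

/-- By joint surjectivity each `x` is some `r i` applied to some `c`; set `v x = f 0 c` for a chosen
representation. Sharpness of `X` makes `v` preserve the relation, and failure of the test makes the
value independent of the choice. -/
theorem hasClosedRelations_op {M : Matr} (hMS : M ∈ S) (hM : trivialTest M = false) :
    HasClosedRelations M (SharpRel.{u} S n)ᵒᵖ := by
  intro R C r hr X f hf
  choose u hu using hf
  have hu' : ∀ j i c, (u j).unop.toFun ((r i).unop.toFun c) =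
      (f (M.entry i j)).unop.toFun c := fun j i c => by
    rw [← hu j i]
    rfl
  choose σ c hσ using exists_eq_of_isInternalRelation hr
  let v : R.unop ⟶ X.unop := ⟨fun x => (f 0).unop.toFun (c x), fun x hx => by
    refine X.unop.isSharp M hMS (fun l => σ (x l)) (fun l t => (f t).unop.toFun (c (x l)))
      fun j => ?_
    have h := (u j).unop.map_rel x hx
    have h' : (u j).unop.toFun ∘ x =
        fun l => (f (M.entry (σ (x l)) j)).unop.toFun (c (x l)) := by
      ext l
      rw [← hu', hσ, Function.comp_apply]
    rwa [h'] at h⟩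
  refine ⟨v.op, fun i => Quiver.Hom.unop_inj ?_⟩
  ext y
  refine eq_at_zero_of_trivialTest_eq_false hM (a := σ ((r i).unop.toFun y)) (b := i)
    (g := fun t => (f t).unop.toFun (c ((r i).unop.toFun y)))
    (g' := fun t => (f t).unop.toFun y) fun j => ?_
  rw [← hu', ← hu', hσ]

theorem zeroCol_mem_colS {N : Matr}
    (hN : HasClosedRelations N (SharpRel.{u} S N.n)ᵒᵖ) : zeroCol N ∈ colS S N := by
  let X : SharpRel.{u} S N.n := ⟨ULift.{u} (Fin N.k), {x | ULift.down ∘ x ∈ colS S N},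
    fun M hM => (isSharp_sharpClosure hM (col N)).preimage ULift.down⟩
  -- `C` is a free point and `R` consists of `N.n` points whose tuple is generically related, so
  -- maps `R ⟶ X` are exactly the related tuples of `X`.
  let C : SharpRel.{u} S N.n := free S (X := PUnit.{u + 1}) ∅
  let R : SharpRel.{u} S N.n := free S (X := ULift.{u} (Fin N.n)) {ULift.up}
  let r : Fin N.n → (C ⟶ R) := fun i => free.desc (fun _ => ULift.up i) fun _ h => h.elim
  let f : Fin N.k → (C ⟶ X) := fun t => free.desc (fun _ => ULift.up t) fun _ h => h.elim
  have hr : IsInternalRelation fun i => (r i).op := by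
    intro Y x y hxy
    refine Quiver.Hom.unop_inj ?_
    ext ⟨i⟩
    exact congrArg (fun z => z.unop.toFun PUnit.unit) (hxy i)
  obtain ⟨v, hv⟩ := hN _ hr (Opposite.op X) (fun t => (f t).op) fun j => by
    let w : R ⟶ X := free.desc (fun i => ULift.up (N.entry i.down j)) (by
      rintro _ rfl
      exact subset_sharpClosure S (col N) ⟨j, rfl⟩)
    exact ⟨w.op, fun i => rfl⟩
  have h1 : v.unop.toFun ∘ ULift.up ∈ X.rel :=
    v.unop.map_rel _ (subset_sharpClosure S _ rfl)
  have h2 : v.unop.toFun ∘ ULift.up = fun _ : Fin N.n => ULift.up (0 : Fin N.k) := by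
    ext1 i
    exact congrArg (fun z => z.unop.toFun PUnit.unit) (hv i)
  rw [h2] at h1
  exact h1

end SharpRel

theorem zeroCol_mem_colS_of_mclex_subset {S U : Set Matr} (hS : ∀ M ∈ S, trivialTest M = false)
    (h : mclex.{u} S ⊆ mclex.{u} U) : ∀ N ∈ U, zeroCol N ∈ colS S N := by
  intro N hN
  have h1 : Cat.of (SharpRel.{u} S N.n)ᵒᵖ ∈ mclex.{u} S :=
    ⟨(inferInstance : HasFiniteLimits (SharpRel.{u} S N.n)ᵒᵖ),
      fun M hM => SharpRel.hasClosedRelations_op hM (hS M hM)⟩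
  exact SharpRel.zeroCol_mem_colS ((h h1).2 N hN)

/-! ### Preorders -/

theorem hasClosedRelations_of_isThin {𝒞 : Type*} [Category 𝒞] (h𝒞 : Quiver.IsThin 𝒞) {M : Matr}
    (hM : M.m ≠ 0) : HasClosedRelations M 𝒞 := by
  intro R C r _ X f hf
  obtain ⟨w, -⟩ := hf ⟨0, Nat.pos_of_ne_zero hM⟩
  exact ⟨w, fun i => (h𝒞 X C).elim _ _⟩

/-- With no columns, closedness has no premises; in a preorder `Y ⟶ ⊤_ 𝒞` is monic, and closing it
over `X` yields a map to `Y`. -/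
theorem HasClosedRelations.nonempty_hom_of_isEmpty {𝒞 : Type*} [Category 𝒞] [HasFiniteLimits 𝒞]
    {M : Matr} (hM : HasClosedRelations M 𝒞) (h : M.m = 0) (X Y : 𝒞) : Nonempty (X ⟶ Y) := by
  have := hM.isThin_of_trivialTest (trivialTest_of_isEmpty h)
  obtain ⟨v, -⟩ := hM (fun _ => terminal.from Y) (fun Z _ _ _ => (this Z Y).elim _ _) X
    (fun _ => terminal.from X) fun j => absurd j.2 (by omega)
  exact ⟨v⟩

theorem mclex_subset_of_isEmpty {S : Set Matr} {M : Matr} (hMS : M ∈ S) (hM : M.m = 0)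
    (U : Set Matr) : mclex.{u} S ⊆ mclex.{u} U := by
  rintro 𝒞 ⟨hlim, hS⟩
  refine ⟨hlim, fun N _ R C r _ X f _ => ?_⟩
  have := (hS M hMS).isThin_of_trivialTest (trivialTest_of_isEmpty hM)
  obtain ⟨v⟩ := (hS M hMS).nonempty_hom_of_isEmpty hM X R
  exact ⟨v, fun i => (this X C).elim _ _⟩

theorem not_mclex_subset_of_isEmpty {S U : Set Matr} (hS : ∀ M ∈ S, M.m ≠ 0) {N : Matr}
    (hNU : N ∈ U) (hN : N.m = 0) : ¬ mclex.{u} S ⊆ mclex.{u} U := by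
  intro h
  -- The chain `false ≤ true` has no arrow back. The inner lift puts the homs in `Type u`, the outer
  -- one the objects in `Type (u + 1)`.
  let 𝒞 := ULift.{u + 1} (ULift.{u} Bool)
  let : Category.{u} 𝒞 := uliftCategory _
  have hlim : HasFiniteLimits 𝒞 := ⟨fun J _ _ =>
    Adjunction.hasLimitsOfShape_of_equivalence
      (ULift.equivalence (C := ULift.{u} Bool)).inverse⟩
  have hthin : Quiver.IsThin 𝒞 := fun X Y =>
    inferInstanceAs (Subsingleton (X.down ⟶ Y.down))
  have h1 : Cat.of 𝒞 ∈ mclex.{u} S :=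
    ⟨hlim, fun M hM => hasClosedRelations_of_isThin hthin (hS M hM)⟩
  have hN' : HasClosedRelations N 𝒞 := (h h1).2 N hNU
  obtain ⟨e⟩ := hN'.nonempty_hom_of_isEmpty hN ⟨⟨true⟩⟩ ⟨⟨false⟩⟩
  have e' : (⟨true⟩ : ULift.{u} Bool) ⟶ ⟨false⟩ := e
  exact absurd (leOfHom e') (by decide)

theorem mclex_subset_of_trivialTest {S U : Set Matr} {M : Matr} (hMS : M ∈ S)
    (hM : trivialTest M = true) (hU : ∀ N ∈ U, N.m ≠ 0) : mclex.{u} S ⊆ mclex.{u} U := by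
  rintro 𝒞 ⟨hlim, hS⟩
  exact ⟨hlim, fun N hN =>
    hasClosedRelations_of_isThin ((hS M hMS).isThin_of_trivialTest hM) (hU N hN)⟩

theorem decideInclusion_iff (S U : List Matr) :
    decideInclusion S U = true ↔ mclex.{u} {M | M ∈ S} ⊆ mclex.{u} {N | N ∈ U} := by
  rw [decideInclusion]
  split_ifs with h1 h2 h3
  · obtain ⟨M, hMS, hM⟩ := h1
    exact iff_of_true rfl (mclex_subset_of_isEmpty (S := {M | M ∈ S}) hMS hM _)
  · obtain ⟨N, hNU, hN⟩ := h2
    exact iff_of_false not_false (not_mclex_subset_of_isEmpty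
      (fun M hMS hM => h1 ⟨M, hMS, hM⟩) (U := {N | N ∈ U}) hNU hN)
  · obtain ⟨M, hMS, hM⟩ := h3
    exact iff_of_true rfl (mclex_subset_of_trivialTest (S := {M | M ∈ S}) hMS hM
      fun N hNU hN => h2 ⟨N, hNU, hN⟩)
  · have key : ∀ N, zeroCol N ∈ expand S (colFinset N) ↔ zeroCol N ∈ colS {M | M ∈ S} N :=
      fun N => by rw [← coe_expand_colFinset, Finset.mem_coe]
    rw [decide_eq_true_iff]
    simp only [key]
    exact ⟨fun h => mclex_subset_of_zeroCol_mem h, zeroCol_mem_colS_of_mclex_subset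
      fun M hMS => Bool.eq_false_iff.2 fun hM => h3 ⟨M, hMS, hM⟩⟩

end LexMatrix

theorem mainTheorem2 :
    (∀ S U : Set LexMatrix.Matr,
      (∀ N ∈ U, LexMatrix.zeroCol N ∈ LexMatrix.colS S N) →
        LexMatrix.mclex.{u} S ⊆ LexMatrix.mclex.{u} U) ∧
    (∀ S U : Set LexMatrix.Matr,
      (∀ M ∈ S, ¬ LexMatrix.IsTrivial.{u} M) →
        LexMatrix.mclex.{u} S ⊆ LexMatrix.mclex.{u} U →
          ∀ N ∈ U, LexMatrix.zeroCol N ∈ LexMatrix.colS S N) ∧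
    (∀ (S : List LexMatrix.Matr) (N : LexMatrix.Matr),
      (LexMatrix.expand S (LexMatrix.colFinset N) : Set (Fin N.n → Fin N.k)) =
        LexMatrix.colS {M | M ∈ S} N) ∧
    (∀ S U : List LexMatrix.Matr,
      LexMatrix.decideInclusion S U = true ↔
        LexMatrix.mclex.{u} {M | M ∈ S} ⊆ LexMatrix.mclex.{u} {N | N ∈ U}) :=
  ⟨fun _ _ h => LexMatrix.mclex_subset_of_zeroCol_mem h,
    fun _ _ hS h => LexMatrix.zeroCol_mem_colS_of_mclex_subset
      (fun M hM => Bool.eq_false_iff.2 fun h' => hS M hM (LexMatrix.isTrivial_of_trivialTest h')) h,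
    LexMatrix.coe_expand_colFinset, LexMatrix.decideInclusion_iff⟩
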